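/- Let $R$ be a commutative ring (for instance $\mathbb{Z}[X,Y]$ or $\mathbb{R}$) and let $X,Y\in R$. The Model II associated Laguerre polynomials $L^{(2)}_n(x;X,Y)$ are the monic polynomials $p_n(x)$ given by $p_{-1}=0$, $p_0=1$ and $p_{n+1}(x)=(x-b_n)p_n(x)-\lambda_n p_{n-1}(x)$, where $b_0=X$, $b_k=2k-1+X+Y$ for $k>0$, and $\lambda_k=(k-1+X)(k-1+Y)$ for $k\ge 1$. Let $\mu_n(X,Y)=\mathcal{L}(x^n)$ be their $n$-th moment, where $\mathcal{L}$ is the unique $R$-linear functional on $R[x]$ with $\mathcal{L}(1)=1$ and $\mathcal{L}(p_mp_n)=0$ for all $m\neq n$. For a permutation $\pi=\pi_1\cdots\pi_m\in\mathfrak{S}_m$, let $\mathrm{RLmin}(\pi)$ be the number of right-to-left minima of $\pi$ (entries $\pi_i$ with $\pi_i<\pi_j$ for all $j>i$), $\mathrm{LRmax}(\pi)$ the number of left-to-right maxima (entries $\pi_i$ with $\pi_i>\pi_j$ for all $j<i$), and $\mathrm{pivot}(\pi)$ the number of entries that are both. Then for every $n\ge 1$ $$\mu_n(X,Y)=X\sum_{\pi\in\mathfrak{S}_{n-1}}(X+1)^{\mathrm{RLmin}(\pi)-\mathrm{pivot}(\pi)}(X+Y)^{\mathrm{pivot}(\pi)}\,Y^{\mathrm{LRmax}(\pi)-\mathrm{pivot}(\pi)},$$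 and equivalently, with $X+1$ in place of $X$, $$\mu_n(X+1,Y)=(X+1)\sum_{\pi\in\mathfrak{S}_{n-1}}(X+2)^{\mathrm{RLmin}(\pi)-\mathrm{pivot}(\pi)}(X+Y+1)^{\mathrm{pivot}(\pi)}\,Y^{\mathrm{LRmax}(\pi)-\mathrm{pivot}(\pi)}.$$ -/

import Mathlib

open Polynomial

noncomputable section

/-- The monic polynomials `p₀ = 1`, `p₁ = x - b₀`,
`p_{n+1} = (x - b_n) p_n - lam_n p_{n-1}` (the value `lam 0` is never used). -/
def recPoly {R : Type*} [CommRing R] (b lam : ℕ → R) : ℕ → R[X]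
  | 0 => 1
  | 1 => X - C (b 0)
  | n + 2 => (X - C (b (n + 1))) * recPoly b lam (n + 1) - C (lam (n + 1)) * recPoly b lam n

/-- `L` is a normalized linear functional for which the polynomials `p_n` are orthogonal
(such as integration against a probability measure for the `p_n`). -/
structure IsOrthogonalityFunctional {R : Type*} [CommRing R] (b lam : ℕ → R)
    (L : R[X] →ₗ[R] R) : Prop where
  map_one : L 1 = 1
  orthogonal : ∀ m n : ℕ, m ≠ n → L (recPoly b lam m * recPoly b lam n) = 0

/-- Auxiliary sequence, used only to show that the orthogonality functional exists:
the numbers `μ₀ = 1`, `μ_n = - ∑_{k<n} [x^k] p_n * μ_k`. -/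
def auxMoment {R : Type*} [CommRing R] (b lam : ℕ → R) (n : ℕ) : R :=
  if n = 0 then 1
  else - ∑ k : Fin n, (recPoly b lam n).coeff k * auxMoment b lam k
termination_by n
decreasing_by exact k.2

theorem recPoly_degree_monic {R : Type*} [CommRing R] [Nontrivial R] (b lam : ℕ → R) (n : ℕ) :
    (recPoly b lam n).natDegree = n ∧ (recPoly b lam n).Monic := by
  induction n using Nat.strong_induction_on with
  | _ n ih =>
    match n, ih with
    | 0, _ => simp [recPoly]
    | 1, _ => exact ⟨by simp [recPoly], by simpa [recPoly] using monic_X_sub_C (b 0)⟩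
    | n + 2, ih =>
      obtain ⟨h1, m1⟩ := ih (n + 1) (by omega)
      obtain ⟨h0, m0⟩ := ih n (by omega)
      have hm : ((X - C (b (n + 1))) * recPoly b lam (n + 1)).Monic := (monic_X_sub_C _).mul m1
      have hd : ((X - C (b (n + 1))) * recPoly b lam (n + 1)).natDegree = n + 2 := by
        rw [(monic_X_sub_C _).natDegree_mul m1, h1, natDegree_X_sub_C]; omega
      have hl : (C (lam (n + 1)) * recPoly b lam n).natDegree
          < ((X - C (b (n + 1))) * recPoly b lam (n + 1)).natDegree := by
        have := natDegree_C_mul_le (lam (n + 1)) (recPoly b lam n)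
        omega
      have hdl := degree_lt_degree hl
      refine ⟨?_, ?_⟩
      · rw [recPoly, natDegree_sub_eq_left_of_natDegree_lt hl, hd]
      · rw [recPoly]; exact hm.sub_of_left hdl

theorem existsUnique_orthogonalityFunctional {R : Type*} [CommRing R] (b lam : ℕ → R) :
    ∃! L : R[X] →ₗ[R] R, IsOrthogonalityFunctional b lam L := by
  rcases subsingleton_or_nontrivial R with hR | hR
  · exact ⟨0, ⟨Subsingleton.elim _ _, fun _ _ _ => Subsingleton.elim _ _⟩,
      fun L _ => LinearMap.ext fun _ => Subsingleton.elim _ _⟩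
  have key : ∀ n, recPoly b lam n
      = X ^ n + ∑ k : Fin n, C ((recPoly b lam n).coeff k) * X ^ (k : ℕ) := by
    intro n
    obtain ⟨h, m⟩ := recPoly_degree_monic b lam n
    conv_lhs => rw [m.as_sum, h]
    rw [Finset.sum_range]
  have hL : ∀ (L : R[X] →ₗ[R] R) (n : ℕ), L (recPoly b lam n)
      = L (X ^ n) + ∑ k : Fin n, (recPoly b lam n).coeff k * L (X ^ (k : ℕ)) := by
    intro L n
    conv_lhs => rw [key n]
    simp [map_add, map_sum, C_mul', map_smul]
  let L : R[X] →ₗ[R] R := Polynomial.lsum fun n => auxMoment b lam n • LinearMap.id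
  have hLX : ∀ n, L (X ^ n) = auxMoment b lam n := by
    intro n
    simp [L, Polynomial.lsum_apply, X_pow_eq_monomial]
  have h1 : L 1 = 1 := by
    have := hLX 0
    rw [pow_zero] at this
    rw [this, auxMoment]; simp
  have hp : ∀ n, n ≠ 0 → L (recPoly b lam n) = 0 := by
    intro n hn
    rw [hL, hLX, auxMoment, if_neg hn]
    simp [hLX]
  have hxp : ∀ k n, k < n → L (X ^ k * recPoly b lam n) = 0 := by
    intro k
    induction k with
    | zero => intro n hn; simpa using hp n (by omega)
    | succ k ih =>
      intro n hn
      obtain ⟨n, rfl⟩ : ∃ m, n = m + 1 := ⟨n - 1, by omega⟩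
      have e : X ^ (k + 1) * recPoly b lam (n + 1)
          = X ^ k * recPoly b lam (n + 2) + b (n + 1) • (X ^ k * recPoly b lam (n + 1))
            + lam (n + 1) • (X ^ k * recPoly b lam n) := by
        rw [recPoly, ← C_mul', ← C_mul']; ring
      rw [e, map_add, map_add, map_smul, map_smul, ih _ (by omega), ih _ (by omega),
        ih _ (by omega)]
      simp
  have hlt : ∀ m n, m < n → L (recPoly b lam m * recPoly b lam n) = 0 := by
    intro m n hmn
    rw [key m, add_mul, map_add, hxp m n hmn, Finset.sum_mul, map_sum, zero_add]
    refine Finset.sum_eq_zero fun k _ => ?_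
    rw [mul_assoc, C_mul', map_smul, hxp _ _ (by omega), smul_zero]
  refine ⟨L, ⟨h1, fun m n hmn => ?_⟩, fun L' hL' => ?_⟩
  · rcases lt_or_gt_of_ne hmn with h | h
    · exact hlt m n h
    · rw [mul_comm]; exact hlt n m h
  · have hX : ∀ n, L' (X ^ n) = L (X ^ n) := by
      intro n
      induction n using Nat.strong_induction_on with
      | _ n ih =>
        rcases Nat.eq_zero_or_pos n with rfl | hn
        · rw [pow_zero, h1, hL'.map_one]
        · have e1 := hL'.orthogonal 0 n (by omega)
          rw [recPoly, one_mul, hL] at e1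
          have e2 := hp n (by omega)
          rw [hL] at e2
          rw [Finset.sum_congr rfl fun (k : Fin n) _ => by rw [ih k k.2]] at e1
          exact add_right_cancel (e1.trans e2.symm)
    refine Polynomial.lhom_ext' fun n => LinearMap.ext_ring ?_
    simpa [X_pow_eq_monomial] using hX n

/-- The unique normalized linear functional for which the `p_n` are orthogonal. -/
def momentFunctional {R : Type*} [CommRing R] (b lam : ℕ → R) : R[X] →ₗ[R] R :=
  (existsUnique_orthogonalityFunctional b lam).choose

theorem momentFunctional_spec {R : Type*} [CommRing R] (b lam : ℕ → R) :
    IsOrthogonalityFunctional b lam (momentFunctional b lam) :=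
  (existsUnique_orthogonalityFunctional b lam).choose_spec.1

/-- The `n`-th moment `μ_n(b_k, lam_k)`. -/
def moment {R : Type*} [CommRing R] (b lam : ℕ → R) (n : ℕ) : R :=
  momentFunctional b lam (X ^ n)

/-- Model II associated Laguerre coefficients: `b₀ = x`, `b_k = 2k - 1 + x + y` for `k > 0`. -/
def modelIIb {R : Type*} [CommRing R] (x y : R) (k : ℕ) : R :=
  if k = 0 then x else 2 * (k : R) - 1 + x + y

/-- Model II associated Laguerre coefficients: `lam_k = (k - 1 + x)(k - 1 + y)`. -/
def modelIIlam {R : Type*} [CommRing R] (x y : R) (k : ℕ) : R :=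
  ((k : R) - 1 + x) * ((k : R) - 1 + y)

end

/-- The set of right-to-left minima `π_i` of `π`. -/
def RLMIN {n : ℕ} (π : Equiv.Perm (Fin n)) : Finset (Fin n) :=
  (Finset.univ.filter fun i => ∀ j, i < j → π i < π j).image π

/-- The set of left-to-right maxima `π_i` of `π`. -/
def LRMAX {n : ℕ} (π : Equiv.Perm (Fin n)) : Finset (Fin n) :=
  (Finset.univ.filter fun i => ∀ j, j < i → π j < π i).image π

/-- The number of right-to-left minima. -/
def RLmin {n : ℕ} (π : Equiv.Perm (Fin n)) : ℕ := (RLMIN π).card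

/-- The number of left-to-right maxima. -/
def LRmax {n : ℕ} (π : Equiv.Perm (Fin n)) : ℕ := (LRMAX π).card

/-- The number of pivots: entries that are both left-to-right maxima and right-to-left minima.
It is at most `RLmin π` and at most `LRmax π`. -/
def pivot {n : ℕ} (π : Equiv.Perm (Fin n)) : ℕ := (LRMAX π ∩ RLMIN π).card

theorem pivot_le {n : ℕ} (π : Equiv.Perm (Fin n)) : pivot π ≤ RLmin π ∧ pivot π ≤ LRmax π :=
  ⟨Finset.card_le_card Finset.inter_subset_right, Finset.card_le_card Finset.inter_subset_left⟩

/-! ### Left-to-right maxima, right-to-left minima, and insertion of an entry -/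

noncomputable section

/-! Both sides are embedded in two-parameter arrays with the same recurrence and boundary values.
Let `P_h` be the Model I polynomials (`modelIPoly`). They are kernel polynomials of Model II: `X *
P_h = p_{h+1} + (x + h) p_h` (`X_mul_modelIPoly`). Orthogonality thus gives `L(X * P_h) = 0` for `h
> 0` and `x` for `h = 0`, and the three-term recurrence of `P_h` determines every `L(X^(m+1) *
P_h)`.

The combinatorial array is `cornerSum` with `N = h + m` and `a = b = h`: a sum over permutation
matrices with empty upper left `h × h` corner, where only extrema outside the first `h` rows
(minima) or columns (maxima) are weighted. Deleting the entry of a boundary column or row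
(`cornerSum_column`, `cornerSum_row`) produces the same recurrence when `A = x + 1`, `B = x + y`, `Y
= y`. At `h = 0` the corner condition is void and `P_0 = 1`, which is the theorem. -/

def IsLRMaxAt {n : ℕ} (π : Equiv.Perm (Fin n)) (i : Fin n) : Prop := ∀ j, j < i → π j < π i

def IsRLMinAt {n : ℕ} (π : Equiv.Perm (Fin n)) (i : Fin n) : Prop := ∀ j, i < j → π i < π j

/-- The permutation whose matrix is that of `σ` with a new row `p` and a new column `v`
meeting in an entry. -/
def insertEntry {N : ℕ} (p v : Fin (N + 1)) (σ : Equiv.Perm (Fin N)) :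
    Equiv.Perm (Fin (N + 1)) :=
  (finSuccEquiv' p).trans ((Equiv.optionCongr σ).trans (finSuccEquiv' v).symm)

@[simp] theorem insertEntry_self {N : ℕ} (p v : Fin (N + 1)) (σ : Equiv.Perm (Fin N)) :
    insertEntry p v σ p = v := by
  simp [insertEntry]

@[simp] theorem insertEntry_succAbove {N : ℕ} (p v : Fin (N + 1)) (σ : Equiv.Perm (Fin N))
    (j : Fin N) : insertEntry p v σ (p.succAbove j) = v.succAbove (σ j) := by
  simp [insertEntry]

theorem insertEntry_bijective {N : ℕ} (v : Fin (N + 1)) :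
    Function.Bijective
      (fun q : Fin (N + 1) × Equiv.Perm (Fin N) => insertEntry q.1 v q.2) := by
  rw [Fintype.bijective_iff_injective_and_card]
  constructor
  · rintro ⟨p, σ⟩ ⟨p', σ'⟩ h
    dsimp only at h
    have hp : p = p' := by
      apply (insertEntry p v σ).injective
      rw [insertEntry_self, h, insertEntry_self]
    subst hp
    have : σ = σ' := by
      ext j
      have := congrArg (fun π => π (p.succAbove j)) h
      simp only [insertEntry_succAbove] at this
      rw [Fin.succAbove_right_injective this]
    rw [this]
  · simp [Fintype.card_perm, Nat.factorial_succ]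

theorem sum_perm_eq_sum_insertEntry {R : Type*} [AddCommMonoid R] {N : ℕ} (v : Fin (N + 1))
    (f : Equiv.Perm (Fin (N + 1)) → R) :
    ∑ π, f π = ∑ p : Fin (N + 1), ∑ σ : Equiv.Perm (Fin N), f (insertEntry p v σ) := by
  rw [← Fintype.sum_prod_type']
  exact ((insertEntry_bijective v).sum_comp f).symm

theorem isLRMaxAt_insertEntry_succAbove {N : ℕ} (p v : Fin (N + 1)) (σ : Equiv.Perm (Fin N))
    (j : Fin N) :
    IsLRMaxAt (insertEntry p v σ) (p.succAbove j) ↔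
      IsLRMaxAt σ j ∧ (p < p.succAbove j → v < v.succAbove (σ j)) := by
  simp only [IsLRMaxAt, Fin.forall_iff_succAbove (p := p), insertEntry_self,
    insertEntry_succAbove, Fin.succAbove_lt_succAbove_iff]
  tauto

theorem isRLMinAt_insertEntry_succAbove {N : ℕ} (p v : Fin (N + 1)) (σ : Equiv.Perm (Fin N))
    (j : Fin N) :
    IsRLMinAt (insertEntry p v σ) (p.succAbove j) ↔
      IsRLMinAt σ j ∧ (p.succAbove j < p → v.succAbove (σ j) < v) := by
  simp only [IsRLMinAt, Fin.forall_iff_succAbove (p := p), insertEntry_self,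
    insertEntry_succAbove, Fin.succAbove_lt_succAbove_iff]
  tauto

theorem isLRMaxAt_symm {n : ℕ} (π : Equiv.Perm (Fin n)) (i : Fin n) :
    IsLRMaxAt π.symm (π i) ↔ IsRLMinAt π i := by
  constructor
  · intro h j hj
    by_contra hc
    have hlt : π j < π i := lt_of_le_of_ne (not_lt.mp hc) fun e => hj.ne' (π.injective e)
    have := h _ hlt
    simp only [Equiv.symm_apply_apply] at this
    exact absurd this hj.asymm
  · intro h j hj
    simp only [Equiv.symm_apply_apply]
    by_contra hc
    have hlt : i < π.symm j := lt_of_le_of_ne (not_lt.mp hc) fun e => by simp [e] at hj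
    have := h _ hlt
    simp only [Equiv.apply_symm_apply] at this
    exact absurd this hj.asymm

theorem isRLMinAt_symm {n : ℕ} (π : Equiv.Perm (Fin n)) (i : Fin n) :
    IsRLMinAt π.symm (π i) ↔ IsLRMaxAt π i := by
  have := isLRMaxAt_symm π.symm (π i)
  simpa using this.symm

/-! ### Weighted sums over permutations with an empty corner -/

/-- The weight of the entry in row `i`: only left-to-right maxima with value at least `b` and
right-to-left minima with position at least `a` are taken into account. -/
def entryWeight {R : Type*} [CommRing R] (A B Y : R) (a b : ℕ) {n : ℕ}
    (π : Equiv.Perm (Fin n)) (i : Fin n) : R :=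
  open Classical in
  if (b ≤ (π i : ℕ) ∧ IsLRMaxAt π i) ∧ (a ≤ (i : ℕ) ∧ IsRLMinAt π i) then B
  else (if b ≤ (π i : ℕ) ∧ IsLRMaxAt π i then Y else 1) *
    (if a ≤ (i : ℕ) ∧ IsRLMinAt π i then A else 1)

/-- The matrix of `π` has no entry in its upper left `a × b` corner. -/
def HasEmptyCorner (a b : ℕ) {n : ℕ} (π : Equiv.Perm (Fin n)) : Prop :=
  ∀ i : Fin n, (i : ℕ) < a → b ≤ (π i : ℕ)

/-- The weight of `π`, cut off to permutations with an empty `a × b` corner. -/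
def cornerWeight {R : Type*} [CommRing R] (A B Y : R) (a b : ℕ) {n : ℕ}
    (π : Equiv.Perm (Fin n)) : R :=
  open Classical in
  if HasEmptyCorner a b π then ∏ i, entryWeight A B Y a b π i else 0

/-- The diagonal values `a = b` match the moments; off-diagonal ones are intermediate steps between
consecutive corners. -/
def cornerSum {R : Type*} [CommRing R] (A B Y : R) (N a b : ℕ) : R :=
  ∑ π : Equiv.Perm (Fin N), cornerWeight A B Y a b π

section

variable {R : Type*} [CommRing R] (A B Y : R)

theorem entryWeight_congr {a b a' b' n n' : ℕ} {π : Equiv.Perm (Fin n)}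
    {π' : Equiv.Perm (Fin n')} {i : Fin n} {i' : Fin n'}
    (h₁ : (b ≤ (π i : ℕ) ∧ IsLRMaxAt π i) ↔ (b' ≤ (π' i' : ℕ) ∧ IsLRMaxAt π' i'))
    (h₂ : (a ≤ (i : ℕ) ∧ IsRLMinAt π i) ↔ (a' ≤ (i' : ℕ) ∧ IsRLMinAt π' i')) :
    entryWeight A B Y a b π i = entryWeight A B Y a' b' π' i' := by
  unfold entryWeight
  congr 1
  · rw [h₁, h₂]
  · congr 1
    · congr 1
      rw [h₁]
    · congr 1
      rw [h₂]

/-! ### Symmetry under inversion -/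

theorem entryWeight_symm {n : ℕ} (a b : ℕ) (π : Equiv.Perm (Fin n)) (i : Fin n) :
    entryWeight A B Y a b π.symm (π i) = entryWeight Y B A b a π i := by
  have h₁ : (b ≤ (π.symm (π i) : ℕ) ∧ IsLRMaxAt π.symm (π i)) ↔
      (b ≤ (i : ℕ) ∧ IsRLMinAt π i) := by
    rw [isLRMaxAt_symm, Equiv.symm_apply_apply]
  have h₂ : (a ≤ (π i : ℕ) ∧ IsRLMinAt π.symm (π i)) ↔ (a ≤ (π i : ℕ) ∧ IsLRMaxAt π i) := by
    rw [isRLMinAt_symm]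
  unfold entryWeight
  rw [mul_comm]
  congr 1
  · rw [h₁, h₂, and_comm]
  · congr 1
    · congr 1
      rw [h₂]
    · congr 1
      rw [h₁]

theorem hasEmptyCorner_symm {n : ℕ} (a b : ℕ) (π : Equiv.Perm (Fin n)) :
    HasEmptyCorner a b π.symm ↔ HasEmptyCorner b a π := by
  have key : ∀ (a b : ℕ) (π : Equiv.Perm (Fin n)),
      HasEmptyCorner b a π → HasEmptyCorner a b π.symm := by
    intro a b π h i hi
    by_contra hc
    have := h _ (not_le.mp hc)
    simp only [Equiv.apply_symm_apply] at this
    omega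
  exact ⟨fun h => by simpa using key b a π.symm h, key a b π⟩

theorem cornerWeight_symm {n : ℕ} (a b : ℕ) (π : Equiv.Perm (Fin n)) :
    cornerWeight A B Y a b π.symm = cornerWeight Y B A b a π := by
  unfold cornerWeight
  by_cases h : HasEmptyCorner b a π
  swap
  · rw [if_neg h, if_neg (mt (hasEmptyCorner_symm a b π).mp h)]
  rw [if_pos h, if_pos ((hasEmptyCorner_symm a b π).mpr h), ← Equiv.prod_comp π (fun i => entryWeight A B Y a b π.symm i)]
  exact Finset.prod_congr rfl fun i _ => entryWeight_symm A B Y a b π i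

/-- Inversion transposes the matrix, exchanging left-to-right maxima with right-to-left minima,
hence `A` with `Y` and `a` with `b`. -/
theorem cornerSum_comm (N a b : ℕ) : cornerSum A B Y N a b = cornerSum Y B A N b a := by
  rw [cornerSum, ← Equiv.sum_comp (Equiv.inv (Equiv.Perm (Fin N)))]
  exact Finset.sum_congr rfl fun π _ => cornerWeight_symm A B Y a b π

/-! ### Recurrences from deleting an entry -/

theorem val_succAbove_eq {N : ℕ} (p : Fin (N + 1)) (j : Fin N) :
    ((p.succAbove j : Fin (N + 1)) : ℕ) = if (j : ℕ) < p then (j : ℕ) else j + 1 := by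
  simp only [Fin.succAbove, Fin.lt_def, Fin.val_castSucc]
  split_ifs <;> simp

/-- If the value `v` sits in one of the first `a + 1` rows, it is the smallest value there, so it is
a left-to-right maximum only in row `0`, and its row is too high to count as a minimum; it can be
deleted. If it sits lower, the larger entry of row `0` keeps it from being a maximum, so raising the
threshold to `v + 1` changes nothing. -/
theorem cornerWeight_insertEntry {N : ℕ} (a : ℕ) (v p : Fin (N + 1)) (σ : Equiv.Perm (Fin N)) :
    cornerWeight A B Y (a + 1) v (insertEntry p v σ)
      = cornerWeight A B Y (a + 1) (v + 1) (insertEntry p v σ)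
        + (if (p : ℕ) < a + 1 then (if (p : ℕ) = 0 then Y else 1) else 0)
          * cornerWeight A B Y a v σ := by
  set π := insertEntry p v σ with hπ
  by_cases hp : (p : ℕ) < a + 1
  · have hn : ¬ HasEmptyCorner (a + 1) (v + 1) π := fun h => by
      have := h p hp
      simp only [hπ, insertEntry_self] at this
      omega
    have hc : HasEmptyCorner (a + 1) v π ↔ HasEmptyCorner a v σ := by
      simp only [HasEmptyCorner, hπ, Fin.forall_iff_succAbove (p := p), insertEntry_self,
        insertEntry_succAbove, val_succAbove_eq, le_refl, implies_true, true_and]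
      refine forall_congr' fun j => ?_
      split_ifs <;> omega
    rw [cornerWeight, cornerWeight, cornerWeight, if_neg hn, zero_add, if_pos hp]
    by_cases h : HasEmptyCorner a v σ
    · rw [if_pos h, if_pos (hc.mpr h), Fin.prod_univ_succAbove _ p]
      congr 1
      · have h1 : ¬ (a + 1 ≤ (p : ℕ)) := by omega
        have h2 : IsLRMaxAt π p ↔ (p : ℕ) = 0 := by
          constructor
          · intro hl
            by_contra h0
            have h3 : (⟨0, by omega⟩ : Fin (N + 1)) < p := by
              simp only [Fin.lt_def]; omega
            have h4 := hl _ h3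
            have h5 := hc.mpr h ⟨0, by omega⟩ (by simp)
            simp only [hπ, insertEntry_self, Fin.lt_def] at h4 h5
            omega
          · intro h0 j hj
            simp only [Fin.lt_def] at hj
            omega
        simp only [entryWeight, h1, h2, false_and, and_false, if_false, mul_one]
        simp [hπ]
      -- The deleted entry obstructs only maxima of value below `v` and minima in rows above `p`,
      -- none of which are weighted.
      · refine Finset.prod_congr rfl fun j _ => entryWeight_congr _ _ _ ?_ ?_
        · rw [hπ, isLRMaxAt_insertEntry_succAbove, insertEntry_succAbove]
          simp only [Fin.lt_def, val_succAbove_eq]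
          split_ifs <;> constructor <;> rintro ⟨h1, h2⟩ <;> simp_all <;> omega
        · rw [hπ, isRLMinAt_insertEntry_succAbove]
          simp only [Fin.lt_def, val_succAbove_eq]
          split_ifs <;> constructor <;> rintro ⟨h1, h2⟩ <;> simp_all <;> omega
    · rw [if_neg h, if_neg (mt hc.mp h), mul_zero]
  · rw [if_neg hp, zero_mul, add_zero, cornerWeight, cornerWeight]
    have hpv : ∀ i : Fin (N + 1), (i : ℕ) ≠ p → (π i : ℕ) ≠ v := by
      intro i hi he
      apply hi
      have : π i = π p := by
        rw [hπ, insertEntry_self]; exact Fin.ext he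
      rw [π.injective this]
    have hc : HasEmptyCorner (a + 1) v π ↔ HasEmptyCorner (a + 1) (v + 1) π := by
      refine forall_congr' fun i => imp_congr_right fun hi => ?_
      have := hpv i (by omega)
      omega
    by_cases h : HasEmptyCorner (a + 1) (v + 1) π
    · rw [if_pos h, if_pos (hc.mpr h)]
      refine Finset.prod_congr rfl fun i _ => entryWeight_congr _ _ _ ?_ Iff.rfl
      by_cases hi : (i : ℕ) = p
      · have hip : i = p := Fin.ext hi
        subst hip
        have : ¬ IsLRMaxAt π i := by
          intro hl
          have h3 : (⟨0, by omega⟩ : Fin (N + 1)) < i := by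
            simp only [Fin.lt_def]; omega
          have h4 := hl _ h3
          have h5 := h ⟨0, by omega⟩ (by simp)
          simp only [hπ, insertEntry_self, Fin.lt_def] at h4 h5
          omega
        simp [this]
      · have := hpv i hi
        have : (v : ℕ) ≤ π i ↔ (v : ℕ) + 1 ≤ π i := by omega
        rw [this]
    · rw [if_neg h, if_neg (mt hc.mp h)]

theorem sum_boole_first {N a : ℕ} (ha : a ≤ N) :
    ∑ p : Fin (N + 1), (if (p : ℕ) < a + 1 then (if (p : ℕ) = 0 then Y else 1) else 0)
      = Y + a := by
  have h : (Finset.univ.filter fun i : Fin N => (i : ℕ) < a).card = a := by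
    rw [Fin.card_filter_val_lt]; omega
  rw [Fin.sum_univ_succ]
  simp [h]

theorem cornerSum_column {N a b : ℕ} (ha : a ≤ N) (hb : b ≤ N) :
    cornerSum A B Y (N + 1) (a + 1) b
      = cornerSum A B Y (N + 1) (a + 1) (b + 1) + (Y + a) * cornerSum A B Y N a b := by
  have hv : b = ((⟨b, by omega⟩ : Fin (N + 1)) : ℕ) := rfl
  generalize (⟨b, by omega⟩ : Fin (N + 1)) = v at hv
  subst hv
  simp only [cornerSum]
  rw [sum_perm_eq_sum_insertEntry v, sum_perm_eq_sum_insertEntry v, ← sum_boole_first Y ha,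
    Finset.sum_mul, ← Finset.sum_add_distrib]
  refine Finset.sum_congr rfl fun p _ => ?_
  rw [Finset.mul_sum, ← Finset.sum_add_distrib]
  exact Finset.sum_congr rfl fun σ _ => cornerWeight_insertEntry A B Y a v p σ

theorem cornerSum_row {N a b : ℕ} (ha : a ≤ N) (hb : b ≤ N) :
    cornerSum A B Y (N + 1) a (b + 1)
      = cornerSum A B Y (N + 1) (a + 1) (b + 1) + (A + b) * cornerSum A B Y N a b := by
  rw [cornerSum_comm, cornerSum_column _ _ _ hb ha, cornerSum_comm Y, cornerSum_comm Y]

/-- The value `0` in row `0` is a pivot and affects no other extremum. Otherwise the `1 × 1` corner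
is empty, and neither the value `0` is a maximum nor the entry of row `0` a minimum, so both
thresholds can rise to `1`. -/
theorem cornerWeight_zero_insertEntry {N : ℕ} (p : Fin (N + 1)) (σ : Equiv.Perm (Fin N)) :
    cornerWeight A B Y 0 0 (insertEntry p 0 σ)
      = cornerWeight A B Y 1 1 (insertEntry p 0 σ)
        + (if p = 0 then B else 0) * cornerWeight A B Y 0 0 σ := by
  set π := insertEntry p 0 σ with hπ
  have h0 : ∀ {n : ℕ} (τ : Equiv.Perm (Fin n)), HasEmptyCorner 0 0 τ := fun τ i _ => by simp
  rw [cornerWeight, cornerWeight, cornerWeight, if_pos (h0 _), if_pos (h0 _)]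
  by_cases hp : p = 0
  · subst hp
    have hn : ¬ HasEmptyCorner 1 1 π := fun h => by
      have := h 0 (by simp)
      simp [hπ] at this
    rw [if_neg hn, if_pos rfl, zero_add, Fin.prod_univ_succAbove _ 0]
    congr 1
    · have h1 : IsLRMaxAt π 0 := fun j hj => absurd hj (Fin.not_lt_zero j)
      have h2 : IsRLMinAt π 0 := fun j hj => by
        rw [show π 0 = 0 by simp [hπ]]
        refine Fin.pos_of_ne_zero fun e => hj.ne' (π.injective ?_)
        rw [e]; simp [hπ]
      simp [entryWeight, h1, h2]
    · refine Finset.prod_congr rfl fun j _ => entryWeight_congr _ _ _ ?_ ?_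
      · rw [hπ, isLRMaxAt_insertEntry_succAbove]
        simp
      · rw [hπ, isRLMinAt_insertEntry_succAbove]
        simp
  · have hp0 : π p = 0 := by simp [hπ]
    have h00 : π 0 ≠ 0 := fun e => hp (π.injective (hp0.trans e.symm))
    have hc : HasEmptyCorner 1 1 π := fun i hi => by
      have : i = 0 := Fin.ext (by simpa using hi)
      subst this
      exact Nat.one_le_iff_ne_zero.mpr fun e => h00 (Fin.ext e)
    rw [if_pos hc, if_neg hp, zero_mul, add_zero]
    refine Finset.prod_congr rfl fun i _ => entryWeight_congr _ _ _ ?_ ?_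
    · by_cases hi : π i = 0
      · have : ¬ IsLRMaxAt π i := fun hl => by
          have := hl 0 (Fin.pos_of_ne_zero fun e => h00 (e ▸ hi))
          rw [hi] at this
          exact Fin.not_lt_zero _ this
        simp [this]
      · have : 1 ≤ (π i : ℕ) := Nat.one_le_iff_ne_zero.mpr fun e => hi (Fin.ext e)
        simp [this]
    · by_cases hi : i = 0
      · have : ¬ IsRLMinAt π i := fun hl => by
          subst hi
          have := hl p (Fin.pos_of_ne_zero hp)
          rw [hp0] at this
          exact Fin.not_lt_zero _ this
        simp [this]
      · have : 1 ≤ (i : ℕ) := Nat.one_le_iff_ne_zero.mpr fun e => hi (Fin.ext e)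
        simp [this]

theorem cornerSum_zero_zero (N : ℕ) :
    cornerSum A B Y (N + 1) 0 0 = cornerSum A B Y (N + 1) 1 1 + B * cornerSum A B Y N 0 0 := by
  have hB : B = ∑ p : Fin (N + 1), if p = 0 then B else 0 := by simp
  simp only [cornerSum]
  conv_rhs => rw [sum_perm_eq_sum_insertEntry 0]; arg 2; arg 1; rw [hB]
  rw [sum_perm_eq_sum_insertEntry 0, Finset.sum_mul, ← Finset.sum_add_distrib]
  refine Finset.sum_congr rfl fun p _ => ?_
  rw [Finset.mul_sum, ← Finset.sum_add_distrib]
  exact Finset.sum_congr rfl fun σ _ => cornerWeight_zero_insertEntry A B Y p σ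

theorem cornerSum_self (h : ℕ) : cornerSum A B Y h h h = if h = 0 then 1 else 0 := by
  rcases Nat.eq_zero_or_pos h with rfl | hh
  · simp [cornerSum, cornerWeight, HasEmptyCorner]
  · rw [if_neg hh.ne']
    refine Finset.sum_eq_zero fun π _ => if_neg fun hc => ?_
    have := hc ⟨0, hh⟩ hh
    omega

/-- The corner grows by a column, then by a row. The two orders of deletion contribute `Y + h` and
`A + h + 1` to the middle coefficient; deleting both gives `(Y + h)(A + h)`. -/
theorem cornerSum_succ_succ (h m : ℕ) :
    cornerSum A B Y (h + m + 2) (h + 1) (h + 1)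
      = cornerSum A B Y (h + m + 2) (h + 2) (h + 2)
        + (A + Y + 2 * h + 1) * cornerSum A B Y (h + m + 1) (h + 1) (h + 1)
        + (Y + h) * (A + h) * cornerSum A B Y (h + m) h h := by
  rw [cornerSum_column A B Y (N := h + m + 1) (by omega) (by omega),
    cornerSum_row A B Y (N := h + m + 1) (a := h + 1) (by omega) (by omega),
    cornerSum_row A B Y (N := h + m) (a := h) (by omega) (by omega)]
  push_cast
  ring

theorem cornerSum_zero_eq (N : ℕ) :
    cornerSum A B Y N 0 0 = ∑ π : Equiv.Perm (Fin N),
      A ^ (RLmin π - pivot π) * B ^ pivot π * Y ^ (LRmax π - pivot π) := by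
  classical
  refine Finset.sum_congr rfl fun π _ => ?_
  set s := Finset.univ.filter fun i => IsLRMaxAt π i with hs
  set t := Finset.univ.filter fun i => IsRLMinAt π i with ht
  have hms : ∀ i, i ∈ s ↔ IsLRMaxAt π i := by simp [hs]
  have hmt : ∀ i, i ∈ t ↔ IsRLMinAt π i := by simp [ht]
  have hS : LRMAX π = s.image π := by
    ext v
    simp only [LRMAX, Finset.mem_image, hms, Finset.mem_filter_univ, IsLRMaxAt]
  have hT : RLMIN π = t.image π := by
    ext v
    simp only [RLMIN, Finset.mem_image, hmt, Finset.mem_filter_univ, IsRLMinAt]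
  have hs' : LRmax π = s.card := by
    rw [LRmax, hS, Finset.card_image_of_injective _ π.injective]
  have ht' : RLmin π = t.card := by
    rw [RLmin, hT, Finset.card_image_of_injective _ π.injective]
  have hp' : pivot π = (s ∩ t).card := by
    rw [pivot, hS, hT, ← Finset.image_inter _ _ π.injective,
      Finset.card_image_of_injective _ π.injective]
  have h1 : LRmax π - pivot π = (s \ t).card := by
    rw [hs', hp', Finset.card_sdiff, Finset.inter_comm]
  have h2 : RLmin π - pivot π = (t \ s).card := by
    rw [ht', hp', Finset.card_sdiff]
  -- With both thresholds `0`, the weight splits over the disjoint sets of pure minima, pivots and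
  -- pure maxima.
  have hw : ∀ i, entryWeight A B Y 0 0 π i = (if i ∈ t \ s then A else 1) *
      (if i ∈ s ∩ t then B else 1) * (if i ∈ s \ t then Y else 1) := by
    intro i
    by_cases h : IsLRMaxAt π i <;> by_cases h' : IsRLMinAt π i <;>
      simp [entryWeight, hms, hmt, h, h']
  have h0 : HasEmptyCorner 0 0 π := fun i _ => Nat.zero_le _
  rw [h1, h2, hp', cornerWeight, if_pos h0]
  simp only [hw, Finset.prod_mul_distrib, Finset.prod_ite_mem, Finset.univ_inter,
    Finset.prod_const]

end

/-! ### Model I associated Laguerre polynomials as kernel polynomials of Model II -/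

section

variable {R : Type*} [CommRing R]

/-- Model I associated Laguerre polynomials, with `b_k = 2k + x + y` and
`lam_k = (k + x)(k - 1 + y)`. -/
def modelIPoly (x y : R) : ℕ → R[X] :=
  recPoly (fun k => 2 * (k : R) + x + y) fun k => ((k : R) + x) * ((k : R) - 1 + y)

/-- The constant `x + n` is the one making the right side vanish at `0`, since `p_n(0) = (-1)^n
x(x+1)⋯(x+n-1)`. The proof checks that both sides obey the Model I recurrence. -/
theorem X_mul_modelIPoly (x y : R) (n : ℕ) :
    X * modelIPoly x y n = recPoly (modelIIb x y) (modelIIlam x y) (n + 1)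
      + C (x + n) * recPoly (modelIIb x y) (modelIIlam x y) n := by
  induction n using Nat.strong_induction_on with
  | _ n ih =>
    match n, ih with
    | 0, _ => simp [modelIPoly, recPoly, modelIIb]
    | 1, _ =>
      simp [modelIPoly, recPoly, modelIIb, modelIIlam, map_ofNat C 2]
      ring
    | n + 2, ih =>
      have e0 := ih n (by omega)
      have e1 := ih (n + 1) (by omega)
      have r2 : modelIPoly x y (n + 2) = (X - C (2 * ((n + 1 : ℕ) : R) + x + y)) *
          modelIPoly x y (n + 1) - C ((((n + 1 : ℕ) : R) + x) * (((n + 1 : ℕ) : R) - 1 + y))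
          * modelIPoly x y n := rfl
      have p3 : recPoly (modelIIb x y) (modelIIlam x y) (n + 2 + 1)
          = (X - C (modelIIb x y (n + 2))) * recPoly (modelIIb x y) (modelIIlam x y) (n + 2)
          - C (modelIIlam x y (n + 2)) * recPoly (modelIIb x y) (modelIIlam x y) (n + 1) := rfl
      have p2 : recPoly (modelIIb x y) (modelIIlam x y) (n + 2)
          = (X - C (modelIIb x y (n + 1))) * recPoly (modelIIb x y) (modelIIlam x y) (n + 1)
          - C (modelIIlam x y (n + 1)) * recPoly (modelIIb x y) (modelIIlam x y) n := rfl
      change X * modelIPoly x y (n + 1) = recPoly (modelIIb x y) (modelIIlam x y) (n + 2) +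
        C (x + ((n + 1 : ℕ) : R)) * recPoly (modelIIb x y) (modelIIlam x y) (n + 1) at e1
      rw [r2, p3]
      generalize recPoly (modelIIb x y) (modelIIlam x y) (n + 2) = q2 at *
      generalize recPoly (modelIIb x y) (modelIIlam x y) (n + 1) = q1 at *
      generalize recPoly (modelIIb x y) (modelIIlam x y) n = q0 at *
      simp only [modelIIb, modelIIlam, Nat.succ_ne_zero, if_false, map_add, map_sub, map_mul,
        map_natCast, map_one, map_ofNat, Nat.cast_add, Nat.cast_one, Nat.cast_ofNat]
        at p2 e0 e1 ⊢
      -- The first two terms apply the Model I recurrence to the earlier cases; the last eliminates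
      -- `X * q1` through the Model II recurrence.
      linear_combination (X - (2 * ((n : R[X]) + 1) + C x + C y)) * e1
        - ((n : R[X]) + 1 + C x) * ((n : R[X]) + 1 - 1 + C y) * e0
        - (C x + (n : R[X]) + 1) * p2

theorem momentFunctional_recPoly (b lam : ℕ → R) (n : ℕ) :
    momentFunctional b lam (recPoly b lam (n + 1)) = 0 := by
  simpa [recPoly] using (momentFunctional_spec b lam).orthogonal 0 (n + 1) (by omega)

theorem momentFunctional_X_mul_modelIPoly (x y : R) (h : ℕ) :
    momentFunctional (modelIIb x y) (modelIIlam x y) (X * modelIPoly x y h)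
      = if h = 0 then x else 0 := by
  rw [X_mul_modelIPoly, C_mul', map_add, map_smul, momentFunctional_recPoly]
  rcases h with _ | h
  · simp [recPoly, (momentFunctional_spec (modelIIb x y) (modelIIlam x y)).map_one]
  · simp [momentFunctional_recPoly]

/-- Induction on `m`: at `m = 0` both sides vanish unless `h = 0`, and expanding `X * P_h`
reproduces `cornerSum_zero_zero` or `cornerSum_succ_succ`. -/
theorem momentFunctional_pow_mul_modelIPoly (x y : R) (m h : ℕ) :
    momentFunctional (modelIIb x y) (modelIIlam x y) (X ^ (m + 1) * modelIPoly x y h)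
      = x * cornerSum (x + 1) (x + y) y (h + m) h h := by
  induction m using Nat.strong_induction_on generalizing h with
  | _ m ih =>
    rcases m with _ | m
    · rw [zero_add, pow_one, momentFunctional_X_mul_modelIPoly, add_zero, cornerSum_self]
      split_ifs <;> simp
    · have i1 := ih m (by omega) (h + 1)
      have i0 := ih m (by omega) h
      rcases h with _ | h
      · have e : (X : R[X]) ^ (m + 1 + 1) * modelIPoly x y 0
            = X ^ (m + 1) * modelIPoly x y 1 + (x + y) • (X ^ (m + 1) * modelIPoly x y 0) := by
          simp only [modelIPoly, recPoly, ← C_mul', map_add]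
          simp
          ring
        rw [e, map_add, map_smul, i1, i0, show 0 + (m + 1) = 0 + m + 1 by ring,
          cornerSum_zero_zero, show 0 + 1 + m = 0 + m + 1 by ring, smul_eq_mul]
        ring
      · have i2 := ih m (by omega) h
        have e : (X : R[X]) ^ (m + 1 + 1) * modelIPoly x y (h + 1)
            = X ^ (m + 1) * modelIPoly x y (h + 2)
              + (2 * ((h + 1 : ℕ) : R) + x + y) • (X ^ (m + 1) * modelIPoly x y (h + 1))
              + ((((h + 1 : ℕ) : R) + x) * (((h + 1 : ℕ) : R) - 1 + y))
                • (X ^ (m + 1) * modelIPoly x y h) := by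
          simp only [modelIPoly, recPoly, ← C_mul']
          ring
        rw [e, map_add, map_add, map_smul, map_smul, i1, i0, i2,
          show h + 1 + (m + 1) = h + m + 2 by ring, cornerSum_succ_succ,
          show h + 1 + 1 + m = h + m + 2 by ring, show h + 1 + m = h + m + 1 by ring,
          smul_eq_mul, smul_eq_mul]
        push_cast
        ring

theorem moment_modelII_succ (x y : R) (m : ℕ) :
    moment (modelIIb x y) (modelIIlam x y) (m + 1)
      = x * ∑ π : Equiv.Perm (Fin m),
          (x + 1) ^ (RLmin π - pivot π) * (x + y) ^ pivot π * y ^ (LRmax π - pivot π) := by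
  have := momentFunctional_pow_mul_modelIPoly x y m 0
  rw [zero_add, cornerSum_zero_eq] at this
  rw [moment, ← this]
  simp [modelIPoly, recPoly]

end

end

theorem corollary3p8 {R : Type*} [CommRing R] (x y : R) (n : ℕ) (hn : 1 ≤ n) :
    moment (modelIIb x y) (modelIIlam x y) n
        = x * ∑ π : Equiv.Perm (Fin (n - 1)),
            (x + 1) ^ (RLmin π - pivot π) * (x + y) ^ pivot π * y ^ (LRmax π - pivot π)
    ∧ moment (modelIIb (x + 1) y) (modelIIlam (x + 1) y) n
        = (x + 1) * ∑ π : Equiv.Perm (Fin (n - 1)),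
            (x + 2) ^ (RLmin π - pivot π) * (x + y + 1) ^ pivot π * y ^ (LRmax π - pivot π) := by
  obtain ⟨m, rfl⟩ : ∃ m, n = m + 1 := ⟨n - 1, by omega⟩
  refine ⟨moment_modelII_succ x y m, ?_⟩
  rw [moment_modelII_succ (x + 1) y m, show x + 1 + 1 = x + 2 by ring,
    show x + 1 + y = x + y + 1 by ring, Nat.add_sub_cancel]
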